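/- Norms of matrices are spectral norms (operator norms induced by the Euclidean norms). A real square matrix is Schur stable if all its complex eigenvalues have modulus less than $1$. A pair $(A,B)\in\mathbb{R}^{n\times n}\times\mathbb{R}^{n\times m}$ is stabilizable if $A+BF$ is Schur stable for some $F\in\mathbb{R}^{m\times n}$, and $(A,C)$ with $C\in\mathbb{R}^{p\times n}$ is detectable if $A+LC$ is Schur stable for some $L\in\mathbb{R}^{n\times p}$. A stabilizing solution of the discrete-time algebraic Riccati equation (DARE) for $(A,B,Q,R)$ is a symmetric matrix $P\in\mathbb{R}^{n\times n}$ such that $R+B^{\rm T}PB$ is invertible, $$P=A^{\rm T}PA-A^{\rm T}PB\,(R+B^{\rm T}PB)^{-1}B^{\rm T}PA+Q,$$ and $A-BK$ is Schur stable, where $K=(R+B^{\rm T}PB)^{-1}B^{\rm T}PA$ is the associated infinite-horizon LQR gain. **Proposition.** Let $Q\in\mathbb{R}^{n\times n}$ and $R\in\mathbb{R}^{m\times m}$ be (symmetric) positive definite, and let $A\in\mathbb{R}^{n\times n}$, $B\in\mathbb{R}^{n\times m}$ be such that $(A,B)$ is stabilizable and $(A,Q^{1/2})$ is detectable. Then the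 DARE for $(A,B,Q,R)$ has a unique stabilizing solution; let $K$ be the associated LQR gain. 1. If $(A_k,B_k)_{k\ge 0}$ converges to $(A,B)$ and every $(A_k,B_k)$ is stabilizable, then for every $k$ the DARE for $(A_k,B_k,Q,R)$ has a unique stabilizing solution, and the associated LQR gains $K_k$ converge to $K$. 2. There exist constants $\rho>0$ and $c_K>0$, depending only on $(A,B,Q,R)$, such that for every stabilizable pair $(A',B')$, with $K'$ the LQR gain associated with the stabilizing solution of the DARE for $(A',B',Q,R)$, $\Theta=[A\ \ B]$ and $\Theta'=[A'\ \ B']$: if $\|\Theta'-\Theta\|\le\rho$, then $$\|K'-K\|\le c_K\,\|\Theta'-\Theta\|.$$ In particular, in the situation of 1, $\|K_k-K\|\le c_K\|\Theta_k-\Theta\|$ for every $k$ with $\|\Theta_k-\Theta\|\le\rho$, where $\Theta_k=[A_k\ \ B_k]$. -/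

import Mathlib

open Filter
open scoped Matrix MatrixOrder Matrix.Norms.L2Operator Topology

noncomputable section

namespace LQR

variable {n m p : ℕ}

/-- A real square matrix is Schur stable if all its complex eigenvalues lie in the open unit
disk. -/
def IsSchur (M : Matrix (Fin n) (Fin n) ℝ) : Prop :=
  ∀ z ∈ spectrum ℂ (M.map Complex.ofReal), ‖z‖ < 1

/-- `(A, B)` is stabilizable if some state feedback makes the closed loop Schur stable. -/
def IsStabilizable (A : Matrix (Fin n) (Fin n) ℝ) (B : Matrix (Fin n) (Fin m) ℝ) : Prop :=
  ∃ F : Matrix (Fin m) (Fin n) ℝ, IsSchur (A + B * F)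

/-- `(A, C)` is detectable if some output injection makes the error dynamics Schur stable. -/
def IsDetectable (A : Matrix (Fin n) (Fin n) ℝ) (C : Matrix (Fin p) (Fin n) ℝ) : Prop :=
  ∃ L : Matrix (Fin n) (Fin p) ℝ, IsSchur (A + L * C)

/-- The feedback gain `(R + Bᵀ P B)⁻¹ Bᵀ P A` associated with `P` (control law `u = -K x`). -/
def gain (A : Matrix (Fin n) (Fin n) ℝ) (B : Matrix (Fin n) (Fin m) ℝ)
    (R : Matrix (Fin m) (Fin m) ℝ) (P : Matrix (Fin n) (Fin n) ℝ) :
    Matrix (Fin m) (Fin n) ℝ :=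
  (R + Bᵀ * P * B)⁻¹ * (Bᵀ * P * A)

/-- `P` is a stabilizing solution of the discrete-time algebraic Riccati equation
`P = Aᵀ P A - Aᵀ P B (R + Bᵀ P B)⁻¹ Bᵀ P A + Q`: it is symmetric, the inverse in the equation
exists, the equation holds, and the closed-loop matrix `A - B K` is Schur stable. -/
structure IsStabilizingSolution (A : Matrix (Fin n) (Fin n) ℝ) (B : Matrix (Fin n) (Fin m) ℝ)
    (Q : Matrix (Fin n) (Fin n) ℝ) (R : Matrix (Fin m) (Fin m) ℝ)
    (P : Matrix (Fin n) (Fin n) ℝ) : Prop where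
  isSymm : P.IsSymm
  isUnit : IsUnit (R + Bᵀ * P * B)
  dare : P = Aᵀ * P * A - Aᵀ * P * B * (R + Bᵀ * P * B)⁻¹ * (Bᵀ * P * A) + Q
  schur : IsSchur (A - B * gain A B R P)

open Classical in
/-- The stabilizing solution of the Riccati equation (`0` if there is none). -/
def stabilizingSolution (A : Matrix (Fin n) (Fin n) ℝ) (B : Matrix (Fin n) (Fin m) ℝ)
    (Q : Matrix (Fin n) (Fin n) ℝ) (R : Matrix (Fin m) (Fin m) ℝ) : Matrix (Fin n) (Fin n) ℝ :=
  if h : ∃ P, IsStabilizingSolution A B Q R P then h.choose else 0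

/-- The infinite-horizon LQR gain: the gain of the stabilizing solution. -/
def lqrGain (A : Matrix (Fin n) (Fin n) ℝ) (B : Matrix (Fin n) (Fin m) ℝ)
    (Q : Matrix (Fin n) (Fin n) ℝ) (R : Matrix (Fin m) (Fin m) ℝ) : Matrix (Fin m) (Fin n) ℝ :=
  gain A B R (stabilizingSolution A B Q R)

end LQR

end

/-! Everything is argued in the Loewner order through Bellman supersolutions: pairs `(F, Y)` with `0
≤ Y` and `bellman A B Q R F Y ≤ Y`. Since `Q` is positive definite, Lyapunov's criterion makes `A -
B F` Schur for each such pair, and completing the square shows that `Y` dominates every stabilizing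
solution (`le_of_bellman_le`). Existence comes from a supersolution of minimal trace, uniqueness
from a Sylvester-type identity for the difference of two solutions.

For the perturbation bound, keep the nominal gain `K` and use it on the perturbed system. It moves
the Bellman update of `P` by `O(ε)`, while replacing `P` by `(1 + cε) P` gains a slack `cε (Q + Kᵀ R
K)` that absorbs this error. Hence `P' ≤ (1 + cε) P`, with `c` depending on the solution only
through a bound on its norm (`exists_stabilizingSolution_le`). Exchanging the two systems gives the
reverse inequality, so `‖P' - P‖ = O(ε)`. The gain inherits the Lipschitz bound because `(R + B'ᵀ P'
B')⁻¹` is bounded by a lower bound of `R` alone. Convergence of the gains is then a corollary. -/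

namespace LQR

/-! ### Loewner order and spectral norm -/

section MatrixOrder

variable {n m : ℕ}

lemma transpose_mul_mul_mono {X Y : Matrix (Fin n) (Fin n) ℝ} (h : X ≤ Y)
    (M : Matrix (Fin n) (Fin m) ℝ) : Mᵀ * X * M ≤ Mᵀ * Y * M := by
  rw [Matrix.le_iff] at h ⊢
  have := h.conjTranspose_mul_mul_same M
  rwa [Matrix.conjTranspose_eq_transpose_of_trivial, Matrix.mul_sub, Matrix.sub_mul] at this

lemma transpose_mul_mul_nonneg {X : Matrix (Fin n) (Fin n) ℝ} (h : 0 ≤ X)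
    (M : Matrix (Fin n) (Fin m) ℝ) : 0 ≤ Mᵀ * X * M := by
  simpa using transpose_mul_mul_mono h M

lemma isSymm_of_nonneg {X : Matrix (Fin n) (Fin n) ℝ} (h : 0 ≤ X) : X.IsSymm := by
  have := (Matrix.nonneg_iff_posSemidef.mp h).isHermitian
  rwa [Matrix.IsHermitian, Matrix.conjTranspose_eq_transpose_of_trivial] at this

lemma norm_transpose (M : Matrix (Fin n) (Fin m) ℝ) : ‖Mᵀ‖ = ‖M‖ := by
  rw [← Matrix.conjTranspose_eq_transpose_of_trivial, Matrix.l2_opNorm_conjTranspose]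

lemma dotProduct_self_eq (v : Fin n → ℝ) : v ⬝ᵥ v = ‖WithLp.toLp 2 v‖ ^ 2 := by
  rw [EuclideanSpace.real_norm_sq_eq, dotProduct]
  exact Finset.sum_congr rfl fun i _ => by simp [sq]

lemma nonneg_iff_dotProduct {X : Matrix (Fin n) (Fin n) ℝ} :
    0 ≤ X ↔ X.IsSymm ∧ ∀ v, 0 ≤ v ⬝ᵥ (X *ᵥ v) := by
  rw [Matrix.nonneg_iff_posSemidef, Matrix.posSemidef_iff_dotProduct_mulVec, Matrix.IsHermitian,
    Matrix.conjTranspose_eq_transpose_of_trivial]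
  simp [Matrix.IsSymm]

lemma le_norm_smul_one {X : Matrix (Fin n) (Fin n) ℝ} (h : X.IsSymm) : X ≤ ‖X‖ • 1 := by
  rw [← sub_nonneg, nonneg_iff_dotProduct]
  refine ⟨by simp [Matrix.IsSymm, h.eq], fun v => ?_⟩
  have h1 := Matrix.l2_opNorm_mulVec X (WithLp.toLp 2 v)
  have h2 := real_inner_le_norm (WithLp.toLp 2 (X *ᵥ v)) (WithLp.toLp 2 v)
  have h3 : inner ℝ (WithLp.toLp 2 (X *ᵥ v)) (WithLp.toLp 2 v) = v ⬝ᵥ (X *ᵥ v) := by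
    simp [PiLp.inner_apply, dotProduct]
  have h4 : ‖WithLp.toLp 2 (X *ᵥ v)‖ ≤ ‖X‖ * ‖WithLp.toLp 2 v‖ := h1
  have h5 : v ⬝ᵥ ((‖X‖ • (1 : Matrix (Fin n) (Fin n) ℝ)) *ᵥ v) = ‖X‖ * (v ⬝ᵥ v) := by
    simp [Matrix.smul_mulVec]
  rw [Matrix.sub_mulVec, dotProduct_sub, h5, dotProduct_self_eq]
  rw [h3] at h2
  nlinarith [norm_nonneg (WithLp.toLp 2 v), mul_le_mul_of_nonneg_right h4
    (norm_nonneg (WithLp.toLp 2 v))]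

lemma norm_le_of_transpose_mul_self_le {X : Matrix (Fin n) (Fin m) ℝ} {d : ℝ} (hd : 0 ≤ d)
    (h : Xᵀ * X ≤ d ^ 2 • 1) : ‖X‖ ≤ d := by
  rw [Matrix.l2_opNorm_def]
  refine ContinuousLinearMap.opNorm_le_bound _ hd fun v => ?_
  rw [← sub_nonneg, nonneg_iff_dotProduct] at h
  have h1 := h.2 v.ofLp
  have h2 : v.ofLp ⬝ᵥ ((Xᵀ * X) *ᵥ v.ofLp) = (X *ᵥ v.ofLp) ⬝ᵥ (X *ᵥ v.ofLp) := by
    rw [← Matrix.mulVec_mulVec, Matrix.dotProduct_mulVec, Matrix.vecMul_transpose]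
  rw [Matrix.sub_mulVec, dotProduct_sub, h2, Matrix.smul_mulVec, Matrix.one_mulVec, dotProduct_smul,
    dotProduct_self_eq, dotProduct_self_eq, smul_eq_mul] at h1
  change ‖WithLp.toLp 2 (X *ᵥ v.ofLp)‖ ≤ d * ‖v‖
  refine abs_le_of_sq_le_sq' ?_ (by positivity) |>.2
  have : WithLp.toLp 2 v.ofLp = v := rfl
  rw [this] at h1
  nlinarith

/-- Turns two-sided order bounds into norm bounds without diagonalizing: `d - X` and `d + X`
commute, and two congruences of nonnegative matrices add up to `2d (d² - X²)`. -/
lemma norm_le_of_neg_le_of_le {X : Matrix (Fin n) (Fin n) ℝ} {d : ℝ} (hd : 0 ≤ d)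
    (h₁ : -(d • 1) ≤ X) (h₂ : X ≤ d • 1) : ‖X‖ ≤ d := by
  -- The argument divides by `2d`, so `d = 0` is separate.
  rcases hd.eq_or_lt with rfl | hd
  · have : X = 0 := le_antisymm (by simpa using h₂) (by simpa using h₁)
    simp [this]
  have hX : X.IsSymm := by
    have := isSymm_of_nonneg (sub_nonneg.mpr h₂)
    have h' : X = d • 1 - (d • 1 - X) := by abel
    rw [h', Matrix.IsSymm, Matrix.transpose_sub, this.eq]
    simp
  refine norm_le_of_transpose_mul_self_le hd.le ?_
  have e₁ : 0 ≤ d • 1 - X := sub_nonneg.mpr h₂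
  have e₂ : 0 ≤ d • 1 + X := by
    rw [← neg_le_iff_add_nonneg']; exact h₁
  have f₁ := transpose_mul_mul_nonneg e₁ (d • 1 + X)
  have f₂ := transpose_mul_mul_nonneg e₂ (d • 1 - X)
  rw [(isSymm_of_nonneg e₂).eq] at f₁
  rw [(isSymm_of_nonneg e₁).eq] at f₂
  have key : (d • 1 + X) * (d • 1 - X) * (d • 1 + X) + (d • 1 - X) * (d • 1 + X) * (d • 1 - X)
      = (2 * d) • (d ^ 2 • 1 - Xᵀ * X) := by
    rw [hX.eq]
    simp only [mul_add, add_mul, mul_sub, sub_mul, smul_mul_assoc, mul_smul_comm, mul_one, one_mul,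
      smul_sub, smul_add, smul_smul, mul_assoc]
    module
  have := add_nonneg f₁ f₂
  rw [key] at this
  have h3 := smul_nonneg (inv_nonneg.mpr (by positivity : 0 ≤ 2 * d)) this
  rw [inv_smul_smul₀ (by positivity)] at h3
  exact sub_nonneg.mp h3

lemma norm_mono {X Y : Matrix (Fin n) (Fin n) ℝ} (h₀ : 0 ≤ X) (h : X ≤ Y) : ‖X‖ ≤ ‖Y‖ := by
  have hY := le_norm_smul_one (isSymm_of_nonneg (h₀.trans h))
  refine norm_le_of_neg_le_of_le (norm_nonneg _) (le_trans ?_ h₀) (h.trans hY)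
  exact neg_nonpos.mpr (h₀.trans (h.trans hY))

lemma isClosed_nonneg : IsClosed {X : Matrix (Fin n) (Fin n) ℝ | 0 ≤ X} := by
  simp only [nonneg_iff_dotProduct, Set.ofPred_and, Set.ofPred_forall, Matrix.IsSymm]
  refine (isClosed_eq (by fun_prop) (by fun_prop)).inter (isClosed_iInter fun v => ?_)
  exact isClosed_le continuous_const (by fun_prop)

instance : OrderClosedTopology (Matrix (Fin n) (Fin n) ℝ) where
  isClosed_le' := by
    have := (isClosed_nonneg (n := n)).preimage
      (f := fun p : Matrix (Fin n) (Fin n) ℝ × Matrix (Fin n) (Fin n) ℝ => p.2 - p.1) (by fun_prop)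
    simpa [Set.preimage] using this

lemma exists_pos_smul_one_le {W : Matrix (Fin n) (Fin n) ℝ} (h : W.PosDef) :
    ∃ w : ℝ, 0 < w ∧ w • 1 ≤ W := by
  rcases subsingleton_or_nontrivial (Matrix (Fin n) (Fin n) ℝ) with _ | _
  · exact ⟨1, one_pos, (Subsingleton.elim _ _).le⟩
  have hW : IsSelfAdjoint W := h.isHermitian
  obtain ⟨r, hr, hle⟩ := (CFC.exists_pos_algebraMap_le_iff hW).mpr fun x hx =>
    (Matrix.isStrictlyPositive_iff_posDef.mpr h).spectrum_pos hx
  exact ⟨r, hr, by rwa [Algebra.algebraMap_eq_smul_one] at hle⟩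

/-- If `w I ≤ W` then `w ‖M‖² ≤ ‖Mᵀ W M‖`. -/
lemma norm_sq_le_of_transpose_mul_mul_le {W : Matrix (Fin n) (Fin n) ℝ} {w y : ℝ} (hw : 0 < w)
    (hW : w • 1 ≤ W) {M : Matrix (Fin n) (Fin m) ℝ} (h : Mᵀ * W * M ≤ y • 1) (hy : 0 ≤ y) :
    ‖M‖ ≤ √(y / w) := by
  refine norm_le_of_transpose_mul_self_le (Real.sqrt_nonneg _) ?_
  rw [Real.sq_sqrt (by positivity)]
  have h1 := (transpose_mul_mul_mono hW M).trans h
  have h2 : Mᵀ * (w • 1 : Matrix (Fin n) (Fin n) ℝ) * M = w • (Mᵀ * M) := by simp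
  rw [h2] at h1
  have := smul_le_smul_of_nonneg_left h1 (inv_nonneg.mpr hw.le)
  rwa [inv_smul_smul₀ hw.ne', smul_smul, mul_comm, ← div_eq_mul_inv] at this

end MatrixOrder

/-! ### Schur stability, powers and Lyapunov inequalities -/

section Schur

variable {n : ℕ}

/-- Gelfand's formula for the complexified matrix gives `r < 1` with `‖X ^ k‖ ≤ r ^ k` eventually;
real parts bring the limit back to `M`. -/
lemma IsSchur.tendsto_pow {M : Matrix (Fin n) (Fin n) ℝ} (h : IsSchur M) :
    Tendsto (fun k : ℕ => M ^ k) atTop (𝓝 0) := by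
  rcases subsingleton_or_nontrivial (Matrix (Fin n) (Fin n) ℂ) with _ | _
  · have : IsEmpty (Fin n) := by
      by_contra hn
      rw [not_isEmpty_iff] at hn
      exact zero_ne_one (Subsingleton.elim (0 : Matrix (Fin n) (Fin n) ℂ) 1)
    have : (fun k : ℕ => M ^ k) = fun _ => 0 := funext fun _ => Subsingleton.elim _ _
    rw [this]
    exact tendsto_const_nhds
  set X : Matrix (Fin n) (Fin n) ℂ := M.map Complex.ofReal with hX
  have hρ : spectralRadius ℂ X < (1 : NNReal) :=
    spectrum.spectralRadius_lt_of_forall_lt X fun z hz => by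
      rw [← NNReal.coe_lt_coe]; exact h z hz
  obtain ⟨r, hr, hr1⟩ := ENNReal.lt_iff_exists_nnreal_btwn.mp hρ
  have hr1' : r < 1 := by exact_mod_cast hr1
  have hev := (spectrum.pow_nnnorm_pow_one_div_tendsto_nhds_spectralRadius X).eventually_lt_const hr
  have hX0 : Tendsto (fun k : ℕ => X ^ k) atTop (𝓝 0) := by
    refine squeeze_zero_norm' (a := fun k : ℕ => (r : ℝ) ^ k) ?_
      (tendsto_pow_atTop_nhds_zero_of_lt_one r.2 (by exact_mod_cast hr1'))
    filter_upwards [hev, eventually_gt_atTop 0] with k hk hk0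
    have hk' : (0 : ℝ) < k := by exact_mod_cast hk0
    rw [one_div, ENNReal.rpow_inv_lt_iff hk'] at hk
    rw [ENNReal.rpow_natCast] at hk
    have : ‖X ^ k‖₊ < r ^ k := by exact_mod_cast hk
    have := this.le
    rw [← NNReal.coe_le_coe] at this
    simpa using this
  have hre : Tendsto (fun k : ℕ => (X ^ k).map Complex.re) atTop
      (𝓝 ((0 : Matrix _ _ ℂ).map Complex.re)) :=
    ((continuous_id.matrix_map Complex.continuous_re).tendsto (0 : Matrix (Fin n) (Fin n) ℂ)).comp hX0
  have h0 : ((0 : Matrix (Fin n) (Fin n) ℂ).map Complex.re) = 0 := by ext; simp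
  rw [h0] at hre
  refine hre.congr fun k => ?_
  have : X ^ k = (M ^ k).map Complex.ofReal := by
    rw [hX]
    exact (map_pow (Complex.ofRealHom.mapMatrix) M k).symm
  rw [this]
  ext; simp

lemma isSchur_of_tendsto_pow {M : Matrix (Fin n) (Fin n) ℝ}
    (h : Tendsto (fun k : ℕ => M ^ k) atTop (𝓝 0)) : IsSchur M := by
  intro z hz
  rcases subsingleton_or_nontrivial (Matrix (Fin n) (Fin n) ℂ) with _ | _
  · rw [spectrum.of_subsingleton] at hz
    exact hz.elim
  have hX0 : Tendsto (fun k : ℕ => (M ^ k).map Complex.ofReal) atTop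
      (𝓝 ((0 : Matrix _ _ ℝ).map Complex.ofReal)) :=
    ((continuous_id.matrix_map Complex.continuous_ofReal).tendsto
      (0 : Matrix (Fin n) (Fin n) ℝ)).comp h
  have h0 : ((0 : Matrix (Fin n) (Fin n) ℝ).map Complex.ofReal) = 0 := by ext; simp
  rw [h0] at hX0
  obtain ⟨k, hk⟩ := (hX0.norm.eventually_lt_const
    (by simp : ‖(0 : Matrix (Fin n) (Fin n) ℂ)‖ < 1)).exists
  have hp : (M ^ k).map Complex.ofReal = (M.map Complex.ofReal) ^ k :=
    map_pow (Complex.ofRealHom.mapMatrix) M k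
  rw [hp] at hk
  have := spectrum.norm_le_norm_of_mem (spectrum.pow_mem_pow _ k hz)
  rw [norm_pow] at this
  by_contra! hz1
  exact absurd (one_le_pow₀ hz1 (n := k)) (not_le.mpr (this.trans_lt hk))

lemma transpose_pow_mul_mul_pow_le {M X : Matrix (Fin n) (Fin n) ℝ} {θ : ℝ} (hθ : 0 ≤ θ)
    (h : Mᵀ * X * M ≤ θ • X) (k : ℕ) : (M ^ k)ᵀ * X * M ^ k ≤ θ ^ k • X := by
  induction k with
  | zero => simp
  | succ k ih =>
    have h1 := transpose_mul_mul_mono h (M ^ k)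
    have h2 := smul_le_smul_of_nonneg_left ih hθ
    have e : (M ^ (k + 1))ᵀ * X * M ^ (k + 1) = (M ^ k)ᵀ * (Mᵀ * X * M) * M ^ k := by
      rw [pow_succ', Matrix.transpose_mul]; simp only [mul_assoc]
    rw [e]
    refine h1.trans ?_
    rw [pow_succ', mul_smul]
    simpa using h2

/-- Iterating the hypothesis gives `(M ^ k)ᵀ X M ^ k ≤ X`, and the left side tends to `0`. -/
lemma nonneg_of_transpose_mul_mul_le {M X : Matrix (Fin n) (Fin n) ℝ} (hM : IsSchur M)
    (h : Mᵀ * X * M ≤ X) : 0 ≤ X := by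
  have hlim := hM.tendsto_pow
  have hc : Continuous fun Z : Matrix (Fin n) (Fin n) ℝ => Zᵀ * X * Z := by fun_prop
  have := (hc.tendsto 0).comp hlim
  simp only [Matrix.transpose_zero, zero_mul] at this
  refine le_of_tendsto this (Eventually.of_forall fun k => ?_)
  simpa using transpose_pow_mul_mul_pow_le zero_le_one (by simpa using h) k

/-- Lyapunov's criterion for Schur stability. -/
lemma isSchur_of_lyapunov {M Y W : Matrix (Fin n) (Fin n) ℝ} (hW : W.PosDef) (hY : 0 ≤ Y)
    (h : Mᵀ * Y * M + W ≤ Y) : IsSchur M := by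
  obtain ⟨w, hw, hwW⟩ := exists_pos_smul_one_le hW
  have hwY : w • 1 ≤ Y :=
    hwW.trans ((le_add_of_nonneg_left (transpose_mul_mul_nonneg hY M)).trans h)
  -- Adding `w` keeps `y` positive and `w / y ≤ 1`. As `W ≥ w I ≥ (w / y) Y`, the form `Y` contracts
  -- by the factor `1 - w / y`.
  set y : ℝ := ‖Y‖ + w with hy
  have hy0 : 0 < y := by positivity
  have hYy : Y ≤ y • 1 := (le_norm_smul_one (isSymm_of_nonneg hY)).trans
    (smul_le_smul_of_nonneg_right (by linarith) zero_le_one)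
  have hθ0 : 0 ≤ 1 - w / y := by
    rw [sub_nonneg, div_le_one hy0, hy]; linarith [norm_nonneg Y]
  have hθ1 : 1 - w / y < 1 := by linarith [div_pos hw hy0]
  have hstep : Mᵀ * Y * M ≤ (1 - w / y) • Y := by
    have h1 : (w / y) • Y ≤ W := by
      refine (smul_le_smul_of_nonneg_left hYy (by positivity)).trans ?_
      rwa [smul_smul, div_mul_cancel₀ _ hy0.ne']
    rw [sub_smul, one_smul, le_sub_iff_add_le]
    exact (add_le_add_right h1 _).trans h
  apply isSchur_of_tendsto_pow
  refine squeeze_zero_norm (a := fun k : ℕ => √((1 - w / y) ^ k * y / w)) (fun k => ?_) ?_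
  · refine norm_sq_le_of_transpose_mul_mul_le hw hwY ?_ (by positivity)
    refine (transpose_pow_mul_mul_pow_le hθ0 hstep k).trans ?_
    rw [mul_smul]
    exact smul_le_smul_of_nonneg_left hYy (by positivity)
  · have h1 := tendsto_pow_atTop_nhds_zero_of_lt_one hθ0 hθ1
    have h2 := (Real.continuous_sqrt.tendsto _).comp ((h1.mul_const y).div_const w)
    simpa [Function.comp_def] using h2

/-- Only an inequality is needed, so a partial sum of the Lyapunov series suffices: its telescoping
remainder is at most `W / 2`, and doubling the sum compensates for it. -/
lemma IsSchur.exists_lyapunov {M W : Matrix (Fin n) (Fin n) ℝ} (hM : IsSchur M) (hW : W.PosDef) :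
    ∃ Y, 0 ≤ Y ∧ Mᵀ * Y * M + W ≤ Y := by
  have hW0 : 0 ≤ W := Matrix.nonneg_iff_posSemidef.mpr hW.posSemidef
  obtain ⟨w, hw, hwW⟩ := exists_pos_smul_one_le hW
  have hc : Continuous fun Z : Matrix (Fin n) (Fin n) ℝ => Zᵀ * W * Z := by fun_prop
  have hlim := ((hc.tendsto 0).comp hM.tendsto_pow).norm
  simp only [Matrix.transpose_zero, zero_mul, norm_zero] at hlim
  obtain ⟨N, hN⟩ := (hlim.eventually_lt_const (half_pos hw)).exists
  have hNW : (M ^ N)ᵀ * W * M ^ N ≤ (1 / 2 : ℝ) • W := by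
    have h1 := le_norm_smul_one (isSymm_of_nonneg (transpose_mul_mul_nonneg hW0 (M ^ N)))
    refine h1.trans ((smul_le_smul_of_nonneg_right hN.le zero_le_one).trans ?_)
    rw [div_eq_inv_mul, ← one_div, mul_smul]
    exact smul_le_smul_of_nonneg_left hwW (by norm_num)
  set S := ∑ k ∈ Finset.range N, (M ^ k)ᵀ * W * M ^ k with hS
  have hS0 : 0 ≤ S := Finset.sum_nonneg fun k _ => transpose_mul_mul_nonneg hW0 _
  have hrec : Mᵀ * S * M + W = S + (M ^ N)ᵀ * W * M ^ N := by
    have h1 : Mᵀ * S * M = ∑ k ∈ Finset.range N, (M ^ (k + 1))ᵀ * W * M ^ (k + 1) := by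
      rw [hS, Finset.mul_sum, Finset.sum_mul]
      refine Finset.sum_congr rfl fun k _ => ?_
      rw [pow_succ, Matrix.transpose_mul]; simp only [mul_assoc]
    rw [h1, hS, ← Finset.sum_range_succ (fun k => (M ^ k)ᵀ * W * M ^ k), Finset.sum_range_succ']
    simp
  refine ⟨(2 : ℝ) • S, smul_nonneg (by norm_num) hS0, ?_⟩
  have h2 : Mᵀ * ((2 : ℝ) • S) * M + W = (2 : ℝ) • (Mᵀ * S * M + W) - W := by
    simp only [mul_smul_comm, smul_mul_assoc]; module
  rw [h2, hrec, smul_add, sub_le_iff_le_add]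
  have h3 := smul_le_smul_of_nonneg_left hNW (by norm_num : (0 : ℝ) ≤ 2)
  rw [smul_smul] at h3
  norm_num at h3
  simpa [two_smul] using add_le_add_right h3 ((2 : ℝ) • S)

end Schur

/-! ### Riccati equation: comparison, uniqueness, existence -/

section Riccati

variable {n m : ℕ} {A : Matrix (Fin n) (Fin n) ℝ} {B : Matrix (Fin n) (Fin m) ℝ}
  {Q P Y : Matrix (Fin n) (Fin n) ℝ} {R : Matrix (Fin m) (Fin m) ℝ}

/-- The Bellman update of `P` under the feedback `u = -F x`. -/
def bellman (A : Matrix (Fin n) (Fin n) ℝ) (B : Matrix (Fin n) (Fin m) ℝ)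
    (Q : Matrix (Fin n) (Fin n) ℝ) (R : Matrix (Fin m) (Fin m) ℝ)
    (F : Matrix (Fin m) (Fin n) ℝ) (P : Matrix (Fin n) (Fin n) ℝ) : Matrix (Fin n) (Fin n) ℝ :=
  (A - B * F)ᵀ * P * (A - B * F) + (Q + Fᵀ * R * F)

lemma mul_gain (hG : IsUnit (R + Bᵀ * P * B)) :
    (R + Bᵀ * P * B) * gain A B R P = Bᵀ * P * A := by
  rw [gain, Matrix.mul_nonsing_inv_cancel_left _ _ ((Matrix.isUnit_iff_isUnit_det _).mp hG)]

lemma gain_transpose_mul (hR : R.IsSymm) (hP : P.IsSymm) (hG : IsUnit (R + Bᵀ * P * B)) :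
    (gain A B R P)ᵀ * (R + Bᵀ * P * B) = Aᵀ * P * B := by
  have h := congrArg Matrix.transpose (mul_gain (A := A) hG)
  simpa [Matrix.transpose_mul, hR.eq, hP.eq, Matrix.mul_assoc] using h

lemma riccati_eq (P : Matrix (Fin n) (Fin n) ℝ) :
    Aᵀ * P * A - Aᵀ * P * B * (R + Bᵀ * P * B)⁻¹ * (Bᵀ * P * A) + Q
      = Aᵀ * P * A - Aᵀ * P * B * gain A B R P + Q := by
  rw [gain, Matrix.mul_assoc (Aᵀ * P * B)]

/-- Completion of the square: the Riccati operator minimizes the Bellman update. -/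
lemma bellman_eq_add (hR : R.IsSymm) (hP : P.IsSymm) (hG : IsUnit (R + Bᵀ * P * B))
    (F : Matrix (Fin m) (Fin n) ℝ) :
    bellman A B Q R F P = (Aᵀ * P * A - Aᵀ * P * B * gain A B R P + Q) +
      (F - gain A B R P)ᵀ * (R + Bᵀ * P * B) * (F - gain A B R P) := by
  have h1 := mul_gain (A := A) hG
  have h2 := gain_transpose_mul (A := A) hR hP hG
  have h3 : (F - gain A B R P)ᵀ * (R + Bᵀ * P * B) * (F - gain A B R P)
      = Fᵀ * (R + Bᵀ * P * B) * F - Aᵀ * P * B * F - Fᵀ * (Bᵀ * P * A)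
        + Aᵀ * P * B * gain A B R P := by
    rw [Matrix.transpose_sub, Matrix.sub_mul, h2, Matrix.sub_mul, Matrix.mul_sub, Matrix.mul_sub,
      Matrix.mul_assoc Fᵀ _ (gain A B R P), h1]
    abel
  rw [h3, bellman]
  simp only [Matrix.transpose_sub, Matrix.transpose_mul, Matrix.sub_mul, Matrix.mul_sub,
    Matrix.mul_add, Matrix.add_mul, Matrix.mul_assoc]
  abel

lemma posDef_add_nonneg (hR : R.PosDef) (hP : 0 ≤ P) : (R + Bᵀ * P * B).PosDef :=
  hR.add_posSemidef (Matrix.nonneg_iff_posSemidef.mp (transpose_mul_mul_nonneg hP B))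

lemma isSymm_of_posDef {n : ℕ} {R : Matrix (Fin n) (Fin n) ℝ} (hR : R.PosDef) : R.IsSymm :=
  isSymm_of_nonneg (Matrix.nonneg_iff_posSemidef.mpr hR.posSemidef)

lemma IsStabilizingSolution.eq_riccati (h : IsStabilizingSolution A B Q R P) :
    Aᵀ * P * A - Aᵀ * P * B * gain A B R P + Q = P := by
  rw [← riccati_eq]; exact h.dare.symm

lemma IsStabilizingSolution.bellman_gain (hR : R.IsSymm) (h : IsStabilizingSolution A B Q R P) :
    bellman A B Q R (gain A B R P) P = P := by
  rw [bellman_eq_add hR h.isSymm h.isUnit, h.eq_riccati]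
  simp

lemma weight_posDef (hQ : Q.PosDef) (hR : R.PosDef) (F : Matrix (Fin m) (Fin n) ℝ) :
    (Q + Fᵀ * R * F).PosDef :=
  posDef_add_nonneg hQ (Matrix.nonneg_iff_posSemidef.mpr hR.posSemidef)

/-- The Riccati equation in closed-loop form gives `Mᵀ P M ≤ P` with `M` Schur. -/
lemma IsStabilizingSolution.nonneg (hQ : Q.PosDef) (hR : R.PosDef)
    (h : IsStabilizingSolution A B Q R P) : 0 ≤ P := by
  refine nonneg_of_transpose_mul_mul_le h.schur ?_
  have hb := h.bellman_gain (isSymm_of_posDef hR)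
  have hw := Matrix.nonneg_iff_posSemidef.mpr (weight_posDef hQ hR (gain A B R P)).posSemidef
  conv_rhs => rw [← hb]
  exact le_add_of_nonneg_right hw

/-- A supersolution of some Bellman equation dominates the stabilizing solution. -/
lemma IsStabilizingSolution.le_of_bellman_le (hQ : Q.PosDef) (hR : R.PosDef)
    (h : IsStabilizingSolution A B Q R P) {F : Matrix (Fin m) (Fin n) ℝ} (hY : 0 ≤ Y)
    (hle : bellman A B Q R F Y ≤ Y) : P ≤ Y := by
  have hM : IsSchur (A - B * F) := isSchur_of_lyapunov (weight_posDef hQ hR F) hY hle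
  have hP := h.nonneg hQ hR
  have hG := Matrix.nonneg_iff_posSemidef.mpr (posDef_add_nonneg (B := B) hR hP).posSemidef
  have h1 : P ≤ bellman A B Q R F P := by
    rw [bellman_eq_add (isSymm_of_posDef hR) h.isSymm h.isUnit, h.eq_riccati]
    exact le_add_of_nonneg_right (transpose_mul_mul_nonneg hG _)
  rw [← sub_nonneg]
  refine nonneg_of_transpose_mul_mul_le hM ?_
  have h2 := sub_le_sub hle h1
  refine le_of_eq_of_le ?_ h2
  rw [bellman, bellman, Matrix.mul_sub _ Y P, Matrix.sub_mul _ _ (A - B * F)]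
  abel

/-- With `F` the gain of a second solution, the terms in `Q` and `R` agree, after a transpose, with
those obtained from that second solution, and cancel in the difference. -/
lemma IsStabilizingSolution.eq_mixed (hR : R.IsSymm) (h : IsStabilizingSolution A B Q R P)
    (F : Matrix (Fin m) (Fin n) ℝ) :
    (A - B * gain A B R P)ᵀ * P * (A - B * F) = P - Q - (gain A B R P)ᵀ * R * F := by
  have h1 := gain_transpose_mul (A := A) hR h.isSymm h.isUnit
  have h2 : (gain A B R P)ᵀ * (Bᵀ * P * B) = Aᵀ * P * B - (gain A B R P)ᵀ * R := by
    rw [← h1, Matrix.mul_add]; abel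
  have h3 : (gain A B R P)ᵀ * (Bᵀ * P * A) = Aᵀ * P * B * gain A B R P := by
    rw [← mul_gain h.isUnit, ← Matrix.mul_assoc, h1]
  have h4 : (A - B * gain A B R P)ᵀ * P * (A - B * F)
      = Aᵀ * P * A - (gain A B R P)ᵀ * (Bᵀ * P * A) - Aᵀ * P * B * F
        + (gain A B R P)ᵀ * (Bᵀ * P * B) * F := by
    simp only [Matrix.transpose_sub, Matrix.transpose_mul, Matrix.sub_mul, Matrix.mul_sub,
      Matrix.mul_assoc]
    abel
  rw [h4, h2, h3, Matrix.sub_mul]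
  rw [eq_sub_of_add_eq h.eq_riccati]
  abel

lemma IsStabilizingSolution.unique (hR : R.IsSymm) (hQ : Q.IsSymm)
    (h : IsStabilizingSolution A B Q R P) (h' : IsStabilizingSolution A B Q R Y) : P = Y := by
  have e₁ := h.eq_mixed hR (gain A B R Y)
  have e₂ := congrArg Matrix.transpose (h'.eq_mixed hR (gain A B R P))
  simp only [Matrix.transpose_sub, Matrix.transpose_mul, Matrix.transpose_transpose, h'.isSymm.eq,
    hR.eq, hQ.eq, ← Matrix.mul_assoc] at e₂
  set M₁ := A - B * gain A B R P with hM₁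
  set M₂ := A - B * gain A B R Y with hM₂
  -- Both closed loops are Schur, so iterating this identity forces `P - Y = 0`.
  have hstep : M₁ᵀ * (P - Y) * M₂ = P - Y := by
    rw [Matrix.mul_sub _ P Y, Matrix.sub_mul _ _ M₂, e₁, hM₁, Matrix.transpose_sub, Matrix.transpose_mul, e₂]
    abel
  have hpow (k : ℕ) : (M₁ ^ k)ᵀ * (P - Y) * M₂ ^ k = P - Y := by
    induction k with
    | zero => simp
    | succ k ih =>
      rw [pow_succ', pow_succ', Matrix.transpose_mul]
      calc (M₁ ^ k)ᵀ * M₁ᵀ * (P - Y) * (M₂ * M₂ ^ k)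
          = (M₁ ^ k)ᵀ * (M₁ᵀ * (P - Y) * M₂) * M₂ ^ k := by simp only [mul_assoc]
        _ = _ := by rw [hstep, ih]
  have hc : Continuous fun Z : Matrix (Fin n) (Fin n) ℝ × Matrix (Fin n) (Fin n) ℝ =>
      Z.1ᵀ * (P - Y) * Z.2 := by fun_prop
  have hlim := (hc.tendsto (0, 0)).comp (h.schur.tendsto_pow.prodMk_nhds h'.schur.tendsto_pow)
  simp only [Function.comp_def, ← hM₁, ← hM₂, hpow, mul_zero] at hlim
  exact sub_eq_zero.mp (tendsto_nhds_unique tendsto_const_nhds hlim)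

/-- `Fᵀ R F` is one of the nonnegative summands of the update, hence at most `Y`. -/
lemma norm_le_of_bellman_le (hQ : Q.PosDef) {F : Matrix (Fin m) (Fin n) ℝ} {r : ℝ}
    (hr : 0 < r) (hrR : r • 1 ≤ R) (hY : 0 ≤ Y) (hle : bellman A B Q R F Y ≤ Y) :
    ‖F‖ ≤ √(‖Y‖ / r) := by
  refine norm_sq_le_of_transpose_mul_mul_le hr hrR ?_ (norm_nonneg _)
  refine le_trans ?_ (hle.trans (le_norm_smul_one (isSymm_of_nonneg hY)))
  have hQ0 := Matrix.nonneg_iff_posSemidef.mpr hQ.posSemidef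
  exact (le_add_of_nonneg_left hQ0).trans
    (le_add_of_nonneg_left (transpose_mul_mul_nonneg hY (A - B * F)))

lemma norm_closedLoop_le_of_bellman_le (hQ : Q.PosDef) (hR : R.PosDef)
    {F : Matrix (Fin m) (Fin n) ℝ} {q : ℝ}
    (hq : 0 < q) (hqQ : q • 1 ≤ Q) (hY : 0 ≤ Y) (hle : bellman A B Q R F Y ≤ Y) :
    ‖A - B * F‖ ≤ √(‖Y‖ / q) := by
  have hR0 := Matrix.nonneg_iff_posSemidef.mpr hR.posSemidef
  have hQY : Q ≤ Y := le_trans ((le_add_of_nonneg_right (transpose_mul_mul_nonneg hR0 F)).trans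
    (le_add_of_nonneg_left (transpose_mul_mul_nonneg hY (A - B * F)))) hle
  refine norm_sq_le_of_transpose_mul_mul_le hq (hqQ.trans hQY) ?_ (norm_nonneg _)
  refine le_trans ?_ (hle.trans (le_norm_smul_one (isSymm_of_nonneg hY)))
  exact le_add_of_nonneg_right (Matrix.nonneg_iff_posSemidef.mpr (weight_posDef hQ hR F).posSemidef)

lemma bellman_mono {F : Matrix (Fin m) (Fin n) ℝ} (h : P ≤ Y) :
    bellman A B Q R F P ≤ bellman A B Q R F Y :=
  add_le_add_left (transpose_mul_mul_mono h _) _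

/-- A supersolution of minimal trace solves the Riccati equation. -/
lemma IsStabilizable.exists_isStabilizingSolution (hQ : Q.PosDef) (hR : R.PosDef)
    (h : IsStabilizable A B) : ∃ P, IsStabilizingSolution A B Q R P := by
  obtain ⟨F, hF⟩ := h
  have hF' : IsSchur (A - B * -F) := by simpa using hF
  obtain ⟨P₀, hP₀, hle₀⟩ := hF'.exists_lyapunov (weight_posDef hQ hR (-F))
  obtain ⟨r, hr, hrR⟩ := exists_pos_smul_one_le hR
  set S : Set (Matrix (Fin m) (Fin n) ℝ × Matrix (Fin n) (Fin n) ℝ) :=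
    {z | 0 ≤ z.2 ∧ z.2 ≤ P₀ ∧ bellman A B Q R z.1 z.2 ≤ z.2} with hS
  have hclosed : IsClosed S := by
    refine (isClosed_le continuous_const continuous_snd).inter
      ((isClosed_le continuous_snd continuous_const).inter (isClosed_le ?_ continuous_snd))
    unfold bellman
    fun_prop
  have : ProperSpace (Matrix (Fin m) (Fin n) ℝ) := FiniteDimensional.proper_real _
  have : ProperSpace (Matrix (Fin n) (Fin n) ℝ) := FiniteDimensional.proper_real _
  -- Bounding `Y` by `P₀` also bounds the feedback, through `r ‖F‖² ≤ ‖P₀‖`.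
  have hcompact : IsCompact S := by
    refine ((isCompact_closedBall (0 : Matrix (Fin m) (Fin n) ℝ) √(‖P₀‖ / r)).prod
      (isCompact_closedBall (0 : Matrix (Fin n) (Fin n) ℝ) ‖P₀‖)).of_isClosed_subset hclosed ?_
    rintro ⟨F, P⟩ ⟨h0, h1, h2⟩
    have hn := norm_mono h0 h1
    simp only [Set.mem_prod, mem_closedBall_zero_iff]
    exact ⟨(norm_le_of_bellman_le hQ hr hrR h0 h2).trans
      (Real.sqrt_le_sqrt (by gcongr)), hn⟩
  obtain ⟨⟨F₁, P⟩, ⟨h0, h1, h2⟩, hmin⟩ := hcompact.exists_isMinOn ⟨(-F, P₀), hP₀, le_rfl, hle₀⟩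
    (f := fun z => z.2.trace) (by fun_prop)
  have hPs := isSymm_of_nonneg h0
  have hGpos := posDef_add_nonneg (B := B) hR h0
  have hG := hGpos.isUnit
  have hG0 := Matrix.nonneg_iff_posSemidef.mpr hGpos.posSemidef
  set K := gain A B R P with hK
  set P' := bellman A B Q R K P with hP'
  have e : P' = Aᵀ * P * A - Aᵀ * P * B * gain A B R P + Q := by
    rw [hP', bellman_eq_add (isSymm_of_posDef hR) hPs hG, hK]; simp
  have hP'le : P' ≤ P := by
    refine le_trans ?_ h2
    simp only
    rw [bellman_eq_add (isSymm_of_posDef hR) hPs hG, e]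
    exact le_add_of_nonneg_right (transpose_mul_mul_nonneg hG0 _)
  have hP'0 : 0 ≤ P' := add_nonneg (transpose_mul_mul_nonneg h0 _)
    (Matrix.nonneg_iff_posSemidef.mpr (weight_posDef hQ hR K).posSemidef)
  -- One Bellman step stays in `S`: `P' ≤ P` and monotonicity make `P'` a supersolution for `K`.
  -- Minimality then leaves a positive semidefinite `P - P'` of trace zero.
  have htr : P.trace ≤ P'.trace :=
    hmin (show (K, P') ∈ S from ⟨hP'0, hP'le.trans h1, bellman_mono hP'le⟩)
  have hdiff := Matrix.le_iff.mp hP'le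
  have hz : P - P' = 0 := by
    rw [← hdiff.trace_eq_zero_iff]
    refine le_antisymm ?_ hdiff.trace_nonneg
    rw [Matrix.trace_sub]; linarith
  have hPP : P = P' := sub_eq_zero.mp hz
  refine ⟨P, hPs, hG, ?_, ?_⟩
  · rw [riccati_eq, ← e]; exact hPP
  · exact isSchur_of_lyapunov (weight_posDef hQ hR K) h0 hP'le

lemma IsStabilizable.existsUnique (hQ : Q.PosDef) (hR : R.PosDef)
    (h : IsStabilizable A B) : ∃! P, IsStabilizingSolution A B Q R P := by
  obtain ⟨P, hP⟩ := h.exists_isStabilizingSolution hQ hR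
  exact ⟨P, hP, fun _ hY => hY.unique (isSymm_of_posDef hR) (isSymm_of_posDef hQ) hP⟩

lemma IsStabilizable.isStabilizingSolution (hQ : Q.PosDef) (hR : R.PosDef)
    (h : IsStabilizable A B) :
    IsStabilizingSolution A B Q R (stabilizingSolution A B Q R) := by
  have hex := h.exists_isStabilizingSolution hQ hR
  rw [stabilizingSolution, dif_pos hex]
  exact hex.choose_spec

end Riccati

/-! ### Perturbation of the solution and of the gain -/

section Perturbation

variable {n m : ℕ} {Q : Matrix (Fin n) (Fin n) ℝ} {R : Matrix (Fin m) (Fin m) ℝ}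

lemma norm_mul₃_le {k l a b : ℕ} (X : Matrix (Fin k) (Fin l) ℝ) (Y : Matrix (Fin l) (Fin a) ℝ)
    (Z : Matrix (Fin a) (Fin b) ℝ) : ‖X * Y * Z‖ ≤ ‖X‖ * ‖Y‖ * ‖Z‖ :=
  (Matrix.l2_opNorm_mul _ _).trans
    (mul_le_mul_of_nonneg_right (Matrix.l2_opNorm_mul _ _) (norm_nonneg _))

/-- The feedback is fixed, so only the closed-loop matrix changes, by `D`; the error consists of the
terms containing `D`. -/
lemma bellman_perturbation (A A' : Matrix (Fin n) (Fin n) ℝ) (B B' : Matrix (Fin n) (Fin m) ℝ)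
    (K : Matrix (Fin m) (Fin n) ℝ) (P : Matrix (Fin n) (Fin n) ℝ) (hP : P.IsSymm) :
    bellman A' B' Q R K P ≤ bellman A B Q R K P +
      (‖P‖ * ‖A' - A - (B' - B) * K‖ * (2 * ‖A - B * K‖ + ‖A' - A - (B' - B) * K‖)) • 1 := by
  set M := A - B * K
  set D := A' - A - (B' - B) * K with hD
  have hM' : A' - B' * K = M + D := by rw [hD, Matrix.sub_mul]; simp only [M]; abel
  have h1 : bellman A' B' Q R K P = bellman A B Q R K P +
      (Mᵀ * P * D + Dᵀ * P * M + Dᵀ * P * D) := by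
    rw [bellman, bellman, hM']
    simp only [Matrix.transpose_add, add_mul, mul_add, M]
    abel
  have hs : (Mᵀ * P * D + Dᵀ * P * M + Dᵀ * P * D).IsSymm := by
    simp only [Matrix.IsSymm, Matrix.transpose_add, Matrix.transpose_mul, Matrix.transpose_transpose,
      hP.eq, mul_assoc]
    abel
  rw [h1]
  refine add_le_add_right ((le_norm_smul_one hs).trans
    (smul_le_smul_of_nonneg_right ?_ zero_le_one)) _
  have n1 := norm_mul₃_le Mᵀ P D
  have n2 := norm_mul₃_le Dᵀ P M
  have n3 := norm_mul₃_le Dᵀ P D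
  rw [norm_transpose] at n1 n2 n3
  refine (norm_add₃_le).trans ((add_le_add_three n1 n2 n3).trans (le_of_eq ?_))
  ring

/-- Multiplicative upper perturbation bound for the stabilizing solution. -/
lemma exists_stabilizingSolution_le (hQ : Q.PosDef) (hR : R.PosDef) {p : ℝ} (hp : 0 ≤ p) :
    ∃ c : ℝ, 0 < c ∧ ∀ (A A' : Matrix (Fin n) (Fin n) ℝ) (B B' : Matrix (Fin n) (Fin m) ℝ)
      (P P' : Matrix (Fin n) (Fin n) ℝ) (ε : ℝ),
      IsStabilizingSolution A B Q R P → IsStabilizingSolution A' B' Q R P' → ‖P‖ ≤ p →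
      ‖A' - A‖ ≤ ε → ‖B' - B‖ ≤ ε → c * ε ≤ 1 → P' ≤ (1 + c * ε) • P := by
  obtain ⟨q, hq, hqQ⟩ := exists_pos_smul_one_le hQ
  obtain ⟨r, hr, hrR⟩ := exists_pos_smul_one_le hR
  set κ := √(p / r) with hκ
  set μ := √(p / q) with hμ
  have hκ0 : 0 ≤ κ := Real.sqrt_nonneg _
  have hμ0 : 0 ≤ μ := Real.sqrt_nonneg _
  set c₀ := p * (1 + κ) * (2 * μ + (1 + κ)) with hc₀
  have hc₀0 : 0 ≤ c₀ := by positivity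
  -- The error `(1 + cε) c₀ ε ≤ 2 c₀ ε` must fit in the slack `cε q`. The `+ 1` makes `c ≥ 1`, so
  -- that `cε ≤ 1` implies `ε ≤ 1`.
  refine ⟨2 * (c₀ / q) + 1, by positivity, ?_⟩
  intro A A' B B' P P' ε h h' hPp hA hB hcε
  set c := 2 * (c₀ / q) + 1 with hc
  have hε : 0 ≤ ε := (norm_nonneg _).trans hA
  have hc1 : 1 ≤ c := by have : 0 ≤ c₀ / q := by positivity
                         linarith
  have hε1 : ε ≤ 1 := by nlinarith
  have hP := h.nonneg hQ hR
  have hb := (h.bellman_gain (isSymm_of_posDef hR))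
  set K := gain A B R P
  have hK : ‖K‖ ≤ κ := (norm_le_of_bellman_le hQ hr hrR hP hb.le).trans
    (Real.sqrt_le_sqrt (by gcongr))
  have hM : ‖A - B * K‖ ≤ μ := (norm_closedLoop_le_of_bellman_le hQ hR hq hqQ hP hb.le).trans
    (Real.sqrt_le_sqrt (by gcongr))
  have hD : ‖A' - A - (B' - B) * K‖ ≤ ε * (1 + κ) := by
    refine (norm_sub_le _ _).trans ?_
    have := (Matrix.l2_opNorm_mul (B' - B) K).trans (mul_le_mul hB hK (norm_nonneg _) hε)
    linarith
  have hE : bellman A' B' Q R K P ≤ P + (c₀ * ε) • 1 := by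
    refine (bellman_perturbation A A' B B' K P h.isSymm).trans ?_
    rw [hb]
    refine add_le_add_right (smul_le_smul_of_nonneg_right ?_ zero_le_one) _
    have hD1 : ‖A' - A - (B' - B) * K‖ ≤ 1 + κ :=
      hD.trans (mul_le_of_le_one_left (by positivity) hε1)
    calc _ ≤ p * (ε * (1 + κ)) * (2 * μ + (1 + κ)) := by gcongr
      _ = c₀ * ε := by rw [hc₀]; ring
  have hδ : 0 ≤ c * ε := by positivity
  refine h'.le_of_bellman_le hQ hR (F := K) (smul_nonneg (by positivity) hP) ?_
  -- The update is affine in `P`: scaling `P` does not scale the weight, which is the source of the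
  -- slack.
  have e : bellman A' B' Q R K ((1 + c * ε) • P) =
      (1 + c * ε) • bellman A' B' Q R K P - (c * ε) • (Q + Kᵀ * R * K) := by
    simp only [bellman, mul_smul_comm, smul_mul_assoc]
    module
  rw [e, sub_le_iff_le_add]
  refine (smul_le_smul_of_nonneg_left hE (by positivity)).trans ?_
  rw [smul_add]
  refine add_le_add_right ?_ _
  have hw : q • 1 ≤ Q + Kᵀ * R * K := hqQ.trans (le_add_of_nonneg_right
    (transpose_mul_mul_nonneg (Matrix.nonneg_iff_posSemidef.mpr hR.posSemidef) K))
  refine le_trans ?_ (smul_le_smul_of_nonneg_left hw hδ)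
  rw [smul_smul, smul_smul]
  refine smul_le_smul_of_nonneg_right ?_ zero_le_one
  have hcq : 2 * c₀ ≤ c * q := by
    rw [hc, add_mul, mul_assoc, div_mul_cancel₀ _ hq.ne']; linarith
  have h1 : (1 + c * ε) * (c₀ * ε) ≤ 2 * (c₀ * ε) :=
    mul_le_mul_of_nonneg_right (by linarith) (by positivity)
  nlinarith

lemma exists_norm_stabilizingSolution_sub_le (hQ : Q.PosDef) (hR : R.PosDef)
    {A : Matrix (Fin n) (Fin n) ℝ} {B : Matrix (Fin n) (Fin m) ℝ} {P : Matrix (Fin n) (Fin n) ℝ}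
    (h : IsStabilizingSolution A B Q R P) :
    ∃ δ : ℝ, 0 < δ ∧ ∃ c : ℝ, 0 ≤ c ∧
      ∀ (A' : Matrix (Fin n) (Fin n) ℝ) (B' : Matrix (Fin n) (Fin m) ℝ)
      (P' : Matrix (Fin n) (Fin n) ℝ) (ε : ℝ), IsStabilizingSolution A' B' Q R P' →
      ‖A' - A‖ ≤ ε → ‖B' - B‖ ≤ ε → ε ≤ δ → ‖P' - P‖ ≤ c * ε := by
  obtain ⟨c₁, hc₁, H₁⟩ := exists_stabilizingSolution_le hQ hR (norm_nonneg P)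
  -- The reverse comparison starts from `P'`, and the first one yields `‖P'‖ ≤ 2 ‖P‖`.
  obtain ⟨c₂, hc₂, H₂⟩ := exists_stabilizingSolution_le hQ hR
    (by positivity : 0 ≤ 2 * ‖P‖)
  refine ⟨min c₁⁻¹ c₂⁻¹, by positivity, (c₁ + 2 * c₂) * ‖P‖, by positivity, ?_⟩
  intro A' B' P' ε h' hA hB hεδ
  have hε : 0 ≤ ε := (norm_nonneg _).trans hA
  have h1 : c₁ * ε ≤ 1 := by
    rw [mul_comm, ← le_div_iff₀ hc₁, one_div]; exact hεδ.trans (min_le_left _ _)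
  have h2 : c₂ * ε ≤ 1 := by
    rw [mul_comm, ← le_div_iff₀ hc₂, one_div]; exact hεδ.trans (min_le_right _ _)
  have hP := h.nonneg hQ hR
  have hP' := h'.nonneg hQ hR
  have hle := H₁ A A' B B' P P' ε h h' le_rfl hA hB h1
  have hn : ‖P'‖ ≤ 2 * ‖P‖ := by
    refine (norm_mono hP' hle).trans ?_
    rw [norm_smul, Real.norm_of_nonneg (by positivity)]
    exact mul_le_mul_of_nonneg_right (by linarith) (norm_nonneg _)
  have hge := H₂ A' A B' B P' P ε h' h hn (by rwa [norm_sub_rev]) (by rwa [norm_sub_rev]) h2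
  rw [add_smul, one_smul] at hle hge
  have hPn := le_norm_smul_one h.isSymm
  have hPn' := (le_norm_smul_one h'.isSymm).trans (smul_le_smul_of_nonneg_right hn zero_le_one)
  have b1 : P' - P ≤ ((c₁ + 2 * c₂) * ‖P‖ * ε) • 1 := by
    refine (sub_le_iff_le_add'.mpr hle).trans
      ((smul_le_smul_of_nonneg_left hPn (by positivity)).trans ?_)
    rw [smul_smul]
    refine smul_le_smul_of_nonneg_right ?_ zero_le_one
    have : 0 ≤ 2 * c₂ * ‖P‖ * ε := by positivity
    linarith
  have b2 : P - P' ≤ ((c₁ + 2 * c₂) * ‖P‖ * ε) • 1 := by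
    refine (sub_le_iff_le_add'.mpr hge).trans
      ((smul_le_smul_of_nonneg_left hPn' (by positivity)).trans ?_)
    rw [smul_smul]
    refine smul_le_smul_of_nonneg_right ?_ zero_le_one
    have : 0 ≤ c₁ * ‖P‖ * ε := by positivity
    linarith
  refine norm_le_of_neg_le_of_le (by positivity) ?_ b1
  rw [neg_le, neg_sub]
  exact b2

lemma norm_transpose_mul_mul_sub_le {k l : ℕ} {β η : ℝ} {X X' : Matrix (Fin n) (Fin k) ℝ}
    {P P' : Matrix (Fin n) (Fin n) ℝ} {Y Y' : Matrix (Fin n) (Fin l) ℝ}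
    (hX : ‖X‖ ≤ β) (hP : ‖P‖ ≤ β) (hP' : ‖P'‖ ≤ β) (hY' : ‖Y'‖ ≤ β)
    (dX : ‖X' - X‖ ≤ η) (dP : ‖P' - P‖ ≤ η) (dY : ‖Y' - Y‖ ≤ η) :
    ‖X'ᵀ * P' * Y' - Xᵀ * P * Y‖ ≤ 3 * β ^ 2 * η := by
  have hβ : 0 ≤ β := (norm_nonneg _).trans hX
  have hη : 0 ≤ η := (norm_nonneg _).trans dX
  have e : X'ᵀ * P' * Y' - Xᵀ * P * Y =
      (X' - X)ᵀ * P' * Y' + Xᵀ * (P' - P) * Y' + Xᵀ * P * (Y' - Y) := by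
    simp only [Matrix.transpose_sub, Matrix.sub_mul, Matrix.mul_sub]
    abel
  rw [e]
  have n1 := norm_mul₃_le (X' - X)ᵀ P' Y'
  have n2 := norm_mul₃_le Xᵀ (P' - P) Y'
  have n3 := norm_mul₃_le Xᵀ P (Y' - Y)
  rw [norm_transpose] at n1 n2 n3
  refine (norm_add₃_le).trans ((add_le_add_three n1 n2 n3).trans ?_)
  calc _ ≤ η * β * β + β * η * β + β * β * η := by gcongr
    _ = _ := by ring

/-- Congruence by `G⁻¹` gives `r (G⁻¹)² ≤ G⁻¹`; take norms and cancel one factor. -/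
lemma norm_inv_le {G : Matrix (Fin m) (Fin m) ℝ} {r : ℝ} (hr : 0 < r) (h : r • 1 ≤ G)
    (hG : G.PosDef) : ‖G⁻¹‖ ≤ r⁻¹ := by
  have hu := (Matrix.isUnit_iff_isUnit_det _).mp hG.isUnit
  have hi := isSymm_of_posDef hG.inv
  have h1 := transpose_mul_mul_mono h G⁻¹
  rw [hi.eq, Matrix.nonsing_inv_mul _ hu, one_mul] at h1
  have h3 : G⁻¹ * (r • 1 : Matrix (Fin m) (Fin m) ℝ) * G⁻¹ = r • (G⁻¹ᵀ * G⁻¹) := by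
    rw [hi.eq]; simp
  rw [h3] at h1
  have h4 := norm_mono (smul_nonneg hr.le ?_) h1
  · rw [norm_smul, Real.norm_of_nonneg hr.le, ← Matrix.conjTranspose_eq_transpose_of_trivial,
      Matrix.l2_opNorm_conjTranspose_mul_self] at h4
    rcases (norm_nonneg G⁻¹).eq_or_lt with h0 | h0
    · rw [← h0]; positivity
    · rw [inv_eq_one_div r, le_div_iff₀ hr]
      nlinarith
  · simpa using transpose_mul_mul_nonneg (zero_le_one' (Matrix (Fin m) (Fin m) ℝ)) G⁻¹

lemma exists_norm_lqrGain_sub_le (hQ : Q.PosDef) (hR : R.PosDef)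
    {A : Matrix (Fin n) (Fin n) ℝ} {B : Matrix (Fin n) (Fin m) ℝ} (hAB : IsStabilizable A B) :
    ∃ δ : ℝ, 0 < δ ∧ ∃ c : ℝ, 0 ≤ c ∧
      ∀ (A' : Matrix (Fin n) (Fin n) ℝ) (B' : Matrix (Fin n) (Fin m) ℝ) (ε : ℝ),
      IsStabilizable A' B' → ‖A' - A‖ ≤ ε → ‖B' - B‖ ≤ ε → ε ≤ δ →
      ‖lqrGain A' B' Q R - lqrGain A B Q R‖ ≤ c * ε := by
  have h := hAB.isStabilizingSolution hQ hR
  obtain ⟨δ, hδ, c, hc, H⟩ := exists_norm_stabilizingSolution_sub_le hQ hR h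
  obtain ⟨r, hr, hrR⟩ := exists_pos_smul_one_le hR
  unfold lqrGain
  set P := stabilizingSolution A B Q R
  set K := gain A B R P
  -- A common bound for nominal and perturbed data; the last term covers every deviation when `ε ≤
  -- δ`.
  set β := ‖A‖ + ‖B‖ + ‖P‖ + ‖K‖ + (1 + c) * δ with hβ
  have hβ0 : 0 ≤ β := by positivity
  refine ⟨δ, hδ, r⁻¹ * (3 * β ^ 2 * (1 + c) * (1 + β)), by positivity, ?_⟩
  intro A' B' ε hAB' hA hB hεδ
  have h' := hAB'.isStabilizingSolution hQ hR
  set P' := stabilizingSolution A' B' Q R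
  have hε : 0 ≤ ε := (norm_nonneg _).trans hA
  have hP := H A' B' P' ε h' hA hB hεδ
  have hcε : 0 ≤ c * ε := by positivity
  set η := (1 + c) * ε with hη
  have dA : ‖A' - A‖ ≤ η := by linarith
  have dB : ‖B' - B‖ ≤ η := by linarith
  have dP : ‖P' - P‖ ≤ η := by linarith
  have hηδ : η ≤ (1 + c) * δ := mul_le_mul_of_nonneg_left hεδ (by positivity)
  have hη0 : 0 ≤ η := by positivity
  have nA := norm_nonneg A
  have nB := norm_nonneg B
  have nP := norm_nonneg P
  have nK := norm_nonneg K
  have bB : ‖B‖ ≤ β := by linarith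
  have bP : ‖P‖ ≤ β := by linarith
  have bK : ‖K‖ ≤ β := by linarith
  have bA' : ‖A'‖ ≤ β := by linarith [norm_le_norm_add_norm_sub A A', norm_sub_rev A' A]
  have bB' : ‖B'‖ ≤ β := by linarith [norm_le_norm_add_norm_sub B B', norm_sub_rev B' B]
  have bP' : ‖P'‖ ≤ β := by linarith [norm_le_norm_add_norm_sub P P', norm_sub_rev P' P]
  have e1 := norm_transpose_mul_mul_sub_le bB bP bP' bA' dB dP dA
  have e2 := norm_transpose_mul_mul_sub_le bB bP bP' bB' dB dP dB
  have hP'0 := h'.nonneg hQ hR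
  have hGpos := posDef_add_nonneg (B := B') hR hP'0
  have hu := (Matrix.isUnit_iff_isUnit_det _).mp hGpos.isUnit
  have hGr : r • 1 ≤ R + B'ᵀ * P' * B' :=
    hrR.trans (le_add_of_nonneg_right (transpose_mul_mul_nonneg hP'0 B'))
  have hinv := norm_inv_le hr hGr hGpos
  -- Subtracting the two normal equations avoids differentiating an inverse: only the perturbed
  -- inverse occurs, and `hinv` bounds it.
  have key : gain A' B' R P' - K = (R + B'ᵀ * P' * B')⁻¹ *
      ((B'ᵀ * P' * A' - Bᵀ * P * A) - (B'ᵀ * P' * B' - Bᵀ * P * B) * K) := by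
    have hK : Bᵀ * P * A = (R + Bᵀ * P * B) * K := (mul_gain h.isUnit).symm
    have e3 : (B'ᵀ * P' * A' - Bᵀ * P * A) - (B'ᵀ * P' * B' - Bᵀ * P * B) * K
        = B'ᵀ * P' * A' - (R + B'ᵀ * P' * B') * K := by
      rw [hK]; simp only [Matrix.sub_mul, Matrix.add_mul]; abel
    rw [e3, Matrix.mul_sub, Matrix.nonsing_inv_mul_cancel_left _ _ hu, gain]
  rw [key]
  refine (Matrix.l2_opNorm_mul _ _).trans ?_
  have e4 : ‖(B'ᵀ * P' * A' - Bᵀ * P * A) - (B'ᵀ * P' * B' - Bᵀ * P * B) * K‖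
      ≤ 3 * β ^ 2 * η + 3 * β ^ 2 * η * β :=
    (norm_sub_le _ _).trans (add_le_add e1 ((Matrix.l2_opNorm_mul _ _).trans
      (mul_le_mul e2 bK nK (by positivity))))
  refine (mul_le_mul hinv e4 (norm_nonneg _) (by positivity)).trans (le_of_eq ?_)
  rw [hη]; ring

/-- Each block is `[X Y]` times a fixed selection matrix. The added `1` makes the constant positive
even in dimension zero. -/
lemma exists_norm_le_mul_norm_fromCols : ∃ c : ℝ, 0 < c ∧
    ∀ (X : Matrix (Fin n) (Fin n) ℝ) (Y : Matrix (Fin n) (Fin m) ℝ),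
      ‖X‖ ≤ c * ‖Matrix.fromCols X Y‖ ∧ ‖Y‖ ≤ c * ‖Matrix.fromCols X Y‖ := by
  set E₁ : Matrix (Fin n ⊕ Fin m) (Fin n) ℝ := Matrix.fromRows 1 0
  set E₂ : Matrix (Fin n ⊕ Fin m) (Fin m) ℝ := Matrix.fromRows 0 1
  refine ⟨‖E₁‖ + ‖E₂‖ + 1, by positivity, fun X Y => ⟨?_, ?_⟩⟩
  · have := Matrix.l2_opNorm_mul (Matrix.fromCols X Y) E₁
    rw [Matrix.fromCols_mul_fromRows, mul_one, Matrix.mul_zero, add_zero] at this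
    nlinarith [norm_nonneg (Matrix.fromCols X Y), norm_nonneg E₂]
  · have := Matrix.l2_opNorm_mul (Matrix.fromCols X Y) E₂
    rw [Matrix.fromCols_mul_fromRows, Matrix.mul_one, Matrix.mul_zero, zero_add] at this
    nlinarith [norm_nonneg (Matrix.fromCols X Y), norm_nonneg E₁]

end Perturbation

end LQR

/-- Matrix norms are the spectral norms (operator norms for the Euclidean norms); `CFC.sqrt Q` is
the positive semidefinite square root of `Q`; `Matrix.fromCols A B` is `[A B]`. -/
theorem mainTheorem5 {n m : ℕ}
    (Q : Matrix (Fin n) (Fin n) ℝ) (R : Matrix (Fin m) (Fin m) ℝ)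
    (hQ : Q.PosDef) (hR : R.PosDef)
    (A : Matrix (Fin n) (Fin n) ℝ) (B : Matrix (Fin n) (Fin m) ℝ)
    (hAB : LQR.IsStabilizable A B) (hAQ : LQR.IsDetectable A (CFC.sqrt Q)) :
    (∃! P, LQR.IsStabilizingSolution A B Q R P) ∧
    (∀ (Ak : ℕ → Matrix (Fin n) (Fin n) ℝ) (Bk : ℕ → Matrix (Fin n) (Fin m) ℝ),
      Tendsto Ak atTop (𝓝 A) → Tendsto Bk atTop (𝓝 B) →
      (∀ k, LQR.IsStabilizable (Ak k) (Bk k)) →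
        (∀ k, ∃! P, LQR.IsStabilizingSolution (Ak k) (Bk k) Q R P) ∧
        Tendsto (fun k => LQR.lqrGain (Ak k) (Bk k) Q R) atTop (𝓝 (LQR.lqrGain A B Q R))) ∧
    (∃ ρ : ℝ, 0 < ρ ∧ ∃ cK : ℝ, 0 < cK ∧
      ∀ (A' : Matrix (Fin n) (Fin n) ℝ) (B' : Matrix (Fin n) (Fin m) ℝ),
        LQR.IsStabilizable A' B' →
        ‖Matrix.fromCols A' B' - Matrix.fromCols A B‖ ≤ ρ →
          ‖LQR.lqrGain A' B' Q R - LQR.lqrGain A B Q R‖ ≤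
            cK * ‖Matrix.fromCols A' B' - Matrix.fromCols A B‖) := by
  obtain ⟨δ, hδ, c, hc, H⟩ := LQR.exists_norm_lqrGain_sub_le hQ hR hAB
  refine ⟨hAB.existsUnique hQ hR, fun Ak Bk hA hB hk => ⟨fun k => (hk k).existsUnique hQ hR, ?_⟩, ?_⟩
  · have hε : Tendsto (fun k => ‖Ak k - A‖ + ‖Bk k - B‖) atTop (𝓝 0) := by
      simpa using (tendsto_iff_norm_sub_tendsto_zero.mp hA).add
        (tendsto_iff_norm_sub_tendsto_zero.mp hB)
    rw [tendsto_iff_norm_sub_tendsto_zero]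
    refine squeeze_zero' (Eventually.of_forall fun _ => norm_nonneg _) ?_
      (by simpa using hε.const_mul c)
    filter_upwards [hε.eventually_le_const hδ] with k hkδ
    exact H _ _ _ (hk k) (le_add_of_nonneg_right (norm_nonneg _))
      (le_add_of_nonneg_left (norm_nonneg _)) hkδ
  · obtain ⟨a, ha, hle⟩ := LQR.exists_norm_le_mul_norm_fromCols (n := n) (m := m)
    -- Here `ε = a ‖Θ' - Θ‖` bounds both block deviations; `+ 1` is needed because `c` may vanish.
    refine ⟨δ / a, by positivity, c * a + 1, by positivity, fun A' B' h' hρ => ?_⟩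
    have e : Matrix.fromCols A' B' - Matrix.fromCols A B = Matrix.fromCols (A' - A) (B' - B) := by
      ext i (j | j) <;> simp
    rw [e] at hρ ⊢
    have hle' := hle (A' - A) (B' - B)
    rw [le_div_iff₀ ha, mul_comm] at hρ
    refine (H A' B' _ h' hle'.1 hle'.2 hρ).trans ?_
    nlinarith [norm_nonneg (Matrix.fromCols (A' - A) (B' - B))]
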